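/- **Setting.** Let $d,T\ge 1$ and $n\ge 0$ be integers, let $\Theta\subseteq\mathbb R^d$ be nonempty and compact with $\ell_\infty$-diameter $D$, let $(P_\theta)_{\theta\in\Theta}$ be probability measures on a measurable space $\mathcal X$, and let $M:\Theta\times\Theta\to\mathbb R$ be a measurable loss. A deterministic estimator is a measurable map $\hat\theta:\mathcal X^n\to\Theta$; $\mathcal D$ is the set of these. The risk is $R(\hat\theta,\theta)=\mathbb E_{X\sim P_\theta^{\otimes n}}[M(\hat\theta(X),\theta)]$; these expectations are assumed to exist. For a probability measure (prior) $P$ on $\Theta$ put $R(\hat\theta,P)=\mathbb E_{\theta\sim P}[R(\hat\theta,\theta)]$. A randomized estimator is a probability measure $\mu$ on $\mathcal D$ (equipped with any $\sigma$-algebra for which every $R(\cdot,\theta)$ is measurable), with risk $R(\mu,\theta)=\mathbb E_{\hat\theta\sim\mu}[R(\hat\theta,\theta)]$, and $R^*=\inf_{\mu}\sup_{\theta\in\Theta}R(\mu,\theta)$ is the minimax risk. Assume that for some $L>0$ $$|R(\hat\theta,\theta_1)-R(\hat\theta,\theta_2)|\le L\|\theta_1-\theta_2\|_1\qquad\text{for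 all }\hat\theta\in\mathcal D,\ \theta_1,\theta_2\in\Theta.$$ **Oracles.** An $(\alpha,\beta)$-approximate maximization oracle maps a finite family $\{\hat\theta_i\}_{i=1}^k$ in $\mathcal D$ ($0\le k\le T$) and $\sigma\in\mathbb R^d$, measurably in $\sigma$, to some $\theta'\in\Theta$ with $$\sum_{i=1}^k R(\hat\theta_i,\theta')+\langle\sigma,\theta'\rangle\ \ge\ \sup_{\theta\in\Theta}\Big(\sum_{i=1}^k R(\hat\theta_i,\theta)+\langle\sigma,\theta\rangle\Big)-(\alpha+\beta\|\sigma\|_1).$$ An $\alpha'$-approximate minimization oracle maps a prior $P$ to some $\hat\theta'\in\mathcal D$ with $R(\hat\theta',P)\le\inf_{\hat\theta\in\mathcal D}R(\hat\theta,P)+\alpha'$. **Algorithm.** Given such oracles and $\eta>0$, for $t=1,\dots,T$: let $P_t$ be the distribution of the output of the maximization oracle on $\{\hat\theta_i\}_{i=1}^{t-1}$ and $\sigma$, where $\sigma\in\mathbb R^d$ has i.i.d. $\mathrm{Exp}(\eta)$ coordinates (i.e. $\Pr(\sigma_j\ge s)=e^{-\eta s}$ for $s\ge0$); let $\hat\theta_t$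 be the output of the minimization oracle on $P_t$. Let $\hat\theta_{\mathrm{rnd}}$ be the randomized estimator sampling uniformly from $\hat\theta_1,\dots,\hat\theta_T$, and $P_{\mathrm{avg}}=\frac1T\sum_{t=1}^T P_t$. **Claim.** There is a universal constant $C>0$ such that, in every such setting, if the algorithm is run with $\eta=(dL^2T)^{-1/2}$, then with $$\epsilon=C\left(D\,d^{3/2}LT^{-1/2}+\alpha+\alpha'+\beta d^{3/2}LT^{1/2}\right)$$ the following hold: 1. $\sup_{\theta\in\Theta}R(\hat\theta_{\mathrm{rnd}},\theta)\le R^*+\epsilon$. 2. $\inf_{\hat\theta\in\mathcal D}R(\hat\theta,P_{\mathrm{avg}})\ge R^*-\epsilon$. 3. If moreover $\Theta$ is convex and $M(\cdot,\theta)$ is convex on $\Theta$ for every $\theta\in\Theta$, then the deterministic estimator $\hat\theta_{\mathrm{avg}}=\frac1T\sum_{t=1}^T\hat\theta_t$ satisfies $\sup_{\theta\in\Theta}R(\hat\theta_{\mathrm{avg}},\theta)\le R^*+\epsilon$ and is an approximate Bayes estimator for $P_{\mathrm{avg}}$: $R(\hat\theta_{\mathrm{avg}},P_{\mathrm{avg}})\le\inf_{\hat\theta\in\mathcal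 D}R(\hat\theta,P_{\mathrm{avg}})+\epsilon$. -/

import Mathlib

open MeasureTheory

noncomputable section

/-- A statistical game: a compact nonempty parameter set `Θ ⊆ ℝ^d`, a family of probability
distributions `(P_θ)` on the sample space `𝒳`, and a measurable loss `M : Θ × Θ → ℝ`
(`loss a θ` is the cost of the estimate `a` when the truth is `θ`; only its values on `Θ × Θ` are
ever used). The data are `n` independent samples from `P_θ`. -/
structure StatGame (d n : ℕ) (𝒳 : Type*) [MeasurableSpace 𝒳] where
  Θ : Set (Fin d → ℝ)
  isCompact : IsCompact Θ
  nonempty : Θ.Nonempty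
  model : Θ → Measure 𝒳
  isProb : ∀ θ, IsProbabilityMeasure (model θ)
  loss : (Fin d → ℝ) → (Fin d → ℝ) → ℝ
  measurable_loss : Measurable (fun p : Θ × Θ => loss p.1 p.2)

namespace StatGame

variable {d n : ℕ} {𝒳 : Type*} [MeasurableSpace 𝒳]

/-- Deterministic estimators: measurable maps `𝒳^n → Θ`. -/
structure Estimator (G : StatGame d n 𝒳) where
  toFun : (Fin n → 𝒳) → G.Θ
  measurable_toFun : Measurable toFun

/-- The law of `n` independent samples from `P_θ`. -/
def sampleLaw (G : StatGame d n 𝒳) (θ : G.Θ) : Measure (Fin n → 𝒳) :=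
  Measure.pi (fun _ => G.model θ)

/-- The risk `R(e, θ) = E[M(e(X₁, …, Xₙ), θ)]` of a deterministic estimator. -/
def risk (G : StatGame d n 𝒳) (e : G.Estimator) (θ : G.Θ) : ℝ :=
  ∫ x, G.loss (e.toFun x) θ ∂(G.sampleLaw θ)

/-- The expectations defining the risks of deterministic estimators exist. -/
def HasRisk (G : StatGame d n 𝒳) : Prop :=
  ∀ (e : G.Estimator) (θ : G.Θ), Integrable (fun x => G.loss (e.toFun x) θ) (G.sampleLaw θ)

/-- The risk is `L`-Lipschitz in the parameter with respect to the `ℓ₁` norm. -/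
def RiskLipschitz (G : StatGame d n 𝒳) (L : ℝ) : Prop :=
  ∀ (e : G.Estimator) (θ₁ θ₂ : G.Θ),
    |G.risk e θ₁ - G.risk e θ₂| ≤ L * ∑ j, |(θ₁ : Fin d → ℝ) j - (θ₂ : Fin d → ℝ) j|

/-- The integrated risk `R(e, P) = E_{θ ∼ P} R(e, θ)` under the prior `P`. -/
def bayesRisk (G : StatGame d n 𝒳) (e : G.Estimator) (P : Measure G.Θ) : ℝ :=
  ∫ θ, G.risk e θ ∂P

/-- The risk `R(μ, θ) = E_{e ∼ μ} R(e, θ)` of the randomized estimator `μ`, a probability measure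
on the set of deterministic estimators, as an extended real: the integral of the positive part
minus that of the negative part. -/
def randRisk (G : StatGame d n 𝒳) [MeasurableSpace G.Estimator]
    (μ : Measure G.Estimator) (θ : G.Θ) : EReal :=
  ((∫⁻ e, ENNReal.ofReal (G.risk e θ) ∂μ : ENNReal) : EReal) -
    ((∫⁻ e, ENNReal.ofReal (-(G.risk e θ)) ∂μ : ENNReal) : EReal)

/-- The minimax risk `R* = inf_μ sup_θ R(μ, θ)`, over all randomized estimators `μ`. -/
def minimaxRisk (G : StatGame d n 𝒳) [MeasurableSpace G.Estimator] : EReal :=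
  ⨅ μ : ProbabilityMeasure G.Estimator, ⨆ θ : G.Θ, G.randRisk (μ : Measure G.Estimator) θ

/-- The objective `∑ i, R(e_i, θ) + ⟨σ, θ⟩` of the maximization player. -/
def perturbedRisk (G : StatGame d n 𝒳) (l : List G.Estimator) (σ : Fin d → ℝ) (θ : G.Θ) : ℝ :=
  (l.map (fun e => G.risk e θ)).sum + ∑ j, σ j * (θ : Fin d → ℝ) j

/-- `O` is an `(α, β)`-approximate maximization oracle on families of at most `N` estimators: its
output depends measurably on the perturbation `σ`, and its value is within `α + β ‖σ‖₁` of the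
supremum of the perturbed risk. -/
def IsMaxOracle (G : StatGame d n 𝒳) (α β : ℝ) (N : ℕ)
    (O : List G.Estimator → (Fin d → ℝ) → G.Θ) : Prop :=
  ∀ l : List G.Estimator, l.length ≤ N →
    Measurable (O l) ∧
    ∀ (σ : Fin d → ℝ) (θ : G.Θ),
      G.perturbedRisk l σ θ - (α + β * ∑ j, |σ j|) ≤ G.perturbedRisk l σ (O l σ)

/-- `O` is an `α'`-approximate minimization oracle: for every prior `P`, the integrated risk of
`O P` is within `α'` of the infimum over all deterministic estimators. -/
def IsMinOracle (G : StatGame d n 𝒳) (α' : ℝ) (O : Measure G.Θ → G.Estimator) : Prop :=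
  ∀ P : Measure G.Θ, IsProbabilityMeasure P →
    ∀ e : G.Estimator, G.bayesRisk (O P) P ≤ G.bayesRisk e P + α'

/-- The law of a vector in `ℝ^d` with i.i.d. exponential coordinates of rate `η`. -/
def noiseLaw (d : ℕ) (η : ℝ) : Measure (Fin d → ℝ) :=
  Measure.pi (fun _ => ProbabilityTheory.expMeasure η)

section Algorithm

variable (G : StatGame d n 𝒳) (maxO : List G.Estimator → (Fin d → ℝ) → G.Θ)
  (minO : Measure G.Θ → G.Estimator) (η : ℝ)

/-- The estimators chosen by the minimization player in the first `t` rounds of follow the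
perturbed leader against (approximate) best response. -/
def history : ℕ → List G.Estimator
  | 0 => []
  | t + 1 => history t ++ [minO (Measure.map (maxO (history t)) (noiseLaw d η))]

/-- The prior chosen in round `t + 1`: the law of `maxO {e_1, …, e_t} σ` for exponential `σ`. -/
def prior (t : ℕ) : Measure G.Θ :=
  Measure.map (maxO (G.history maxO minO η t)) (noiseLaw d η)

/-- The estimator chosen in round `t + 1`. -/
def iterate (t : ℕ) : G.Estimator :=
  minO (G.prior maxO minO η t)

/-- The average prior `(P_1 + ⋯ + P_T) / T`. -/
def avgPrior (T : ℕ) : Measure G.Θ :=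
  (T : ENNReal)⁻¹ • ∑ t ∈ Finset.range T, G.prior maxO minO η t

/-- The randomized estimator that samples uniformly from the `T` iterates. -/
def rndEstimator [MeasurableSpace G.Estimator] (T : ℕ) : Measure G.Estimator :=
  (T : ENNReal)⁻¹ • ∑ t ∈ Finset.range T, Measure.dirac (G.iterate maxO minO η t)

/-- The deterministic estimator `x ↦ (e_1(x) + ⋯ + e_T(x)) / T`, the mean of the randomized one.
It takes values in `Θ` because `Θ` is convex. -/
def avgEstimator (hΘ : Convex ℝ G.Θ) (T : ℕ) (hT : 0 < T) : G.Estimator where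
  toFun x := ⟨∑ t ∈ Finset.range T,
      (T : ℝ)⁻¹ • ((G.iterate maxO minO η t).toFun x : Fin d → ℝ), by
    refine hΘ.sum_mem (fun _ _ => by positivity) ?_ (fun t _ => Subtype.coe_prop _)
    have : (T : ℝ) ≠ 0 := by positivity
    simp [this]⟩
  measurable_toFun := by
    refine Measurable.subtype_mk ?_
    refine Finset.measurable_sum _ fun t _ => ?_
    have h : Measurable fun x => ((G.iterate maxO minO η t).toFun x : Fin d → ℝ) :=
      measurable_subtype_coe.comp (G.iterate maxO minO η t).measurable_toFun
    exact h.const_smul (T : ℝ)⁻¹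

end Algorithm

end StatGame

end

/-! Estimation is a zero-sum game: nature plays follow the perturbed leader, the statistician
answers each `P_t` with a near-best response. Let `v` be the average of `R(e_t, P_t)`. Best response
makes every Bayes risk under the average prior at least `v - α'`; low regret for nature makes the
risk of the averaged play at most `v - α' + ε` at every `θ`. Weak duality (Fubini) then traps `R*`
between these two numbers, and all the claims follow.

Regret is bounded by be-the-leader (`IsMaxOracle.sum_risk_le_sum_risk_next`) plus stability
(`IsMaxOracle.integral_displacement_le`). For stability, raising `σ_i` by `c` lifts coordinate `i`
of both consecutive leaders above their old maximum, up to an error containing their own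
displacement, while exponential noise barely notices the shift. A large enough `c` lets the
displacement be absorbed. -/

/-! ### Exponential noise: shifts and first moment. -/

/-- A measure that is dominated by a product measure on all boxes is dominated by it. -/
theorem MeasureTheory.Measure.le_pi_of_forall_box_le {ι : Type*} [Fintype ι] {X : ι → Type*}
    [∀ i, MeasurableSpace (X i)] {μ : ∀ i, Measure (X i)} {ν : Measure (∀ i, X i)}
    (h : ∀ s : ∀ i, Set (X i), (∀ i, MeasurableSet (s i)) →
      ν (Set.univ.pi s) ≤ ∏ i, μ i (s i)) :
    ν ≤ Measure.pi μ := by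
  -- The product measure comes from the largest outer measure bounded by products on boxes;
  -- measurable hulls reduce arbitrary sides to measurable ones.
  have key : ν.toOuterMeasure ≤ OuterMeasure.pi fun i => (μ i).toOuterMeasure := by
    rw [OuterMeasure.le_pi]
    intro s _
    calc ν (Set.univ.pi s)
        ≤ ν (Set.univ.pi fun i => toMeasurable (μ i) (s i)) :=
          measure_mono (Set.pi_mono fun i _ => subset_toMeasurable _ _)
      _ ≤ ∏ i, μ i (toMeasurable (μ i) (s i)) := h _ fun i => measurableSet_toMeasurable _ _
      _ = ∏ i, μ i (s i) := by simp only [measure_toMeasurable]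
  refine Measure.le_iff.2 fun s hs => ?_
  rw [Measure.pi, toMeasure_apply _ _ hs]
  exact key s

namespace ProbabilityTheory

/-- The density satisfies `exp (-ηc) f(x - c) ≤ f(x)`: equality for `x ≥ c`, and the left side
vanishes for `x < c`. -/
theorem ofReal_exp_mul_expMeasure_preimage_add_le {η c : ℝ} (hc : 0 ≤ c)
    {s : Set ℝ} (hs : MeasurableSet s) :
    ENNReal.ofReal (Real.exp (-(η * c))) * expMeasure η ((fun x => x + c) ⁻¹' s) ≤
      expMeasure η s := by
  have hmeas : Measurable (exponentialPDF η) :=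
    (measurable_exponentialPDFReal η).ennreal_ofReal
  have hpre : MeasurableSet ((fun x : ℝ => x + c) ⁻¹' s) := hs.preimage (by fun_prop)
  change _ * (volume.withDensity (exponentialPDF η)) _ ≤ (volume.withDensity (exponentialPDF η)) s
  rw [withDensity_apply _ hpre, withDensity_apply _ hs, ← lintegral_indicator hpre,
    ← lintegral_indicator hs]
  have hshift : ∫⁻ x, ((fun x : ℝ => x + c) ⁻¹' s).indicator (exponentialPDF η) x =
      ∫⁻ x, ((fun x : ℝ => x + c) ⁻¹' s).indicator (exponentialPDF η) (x - c) :=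
    (lintegral_sub_right_eq_self _ c).symm
  rw [hshift, ← lintegral_const_mul' _ _ ENNReal.ofReal_ne_top]
  refine lintegral_mono fun x => ?_
  by_cases hx : x ∈ s
  · rw [Set.indicator_of_mem hx, Set.indicator_of_mem (by simpa using hx)]
    rcases lt_or_ge (x - c) 0 with h | h
    · simp [exponentialPDF_of_neg h]
    · rw [exponentialPDF_of_nonneg h, exponentialPDF_of_nonneg (by linarith),
        ← ENNReal.ofReal_mul (Real.exp_pos _).le]
      refine le_of_eq (congrArg _ ?_)
      rw [mul_left_comm, ← Real.exp_add]
      ring_nf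
  · rw [Set.indicator_of_notMem (by simpa using hx)]
    simp

/-- On `x ≥ 0`, `x · η exp (-ηx)` is `1/η` times the Gamma density of shape 2, which has mass 1. -/
theorem lintegral_abs_expMeasure {η : ℝ} (hη : 0 < η) :
    ∫⁻ x, ENNReal.ofReal |x| ∂(expMeasure η) = ENNReal.ofReal (1 / η) := by
  have hmeas : Measurable (gammaPDF 1 η) := (measurable_gammaPDFReal 1 η).ennreal_ofReal
  have hmeas' : Measurable (gammaPDF 2 η) := (measurable_gammaPDFReal 2 η).ennreal_ofReal
  rw [expMeasure, gammaMeasure, lintegral_withDensity_eq_lintegral_mul _ hmeas (by fun_prop)]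
  have h : ∀ x, (gammaPDF 1 η * fun x => ENNReal.ofReal |x|) x =
      ENNReal.ofReal (1 / η) * gammaPDF 2 η x := by
    intro x
    rcases lt_or_ge x 0 with hx | hx
    · simp [gammaPDF_of_neg hx]
    · rw [Pi.mul_apply, gammaPDF_of_nonneg hx, gammaPDF_of_nonneg hx,
        ← ENNReal.ofReal_mul (by positivity), ← ENNReal.ofReal_mul (by positivity), abs_of_nonneg hx]
      congr 1
      norm_num
      field_simp
  rw [lintegral_congr h, lintegral_const_mul _ hmeas',
    lintegral_gammaPDF_eq_one two_pos hη, mul_one]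

theorem integrable_abs_expMeasure {η : ℝ} (hη : 0 < η) :
    Integrable (fun x : ℝ => |x|) (expMeasure η) := by
  refine ⟨by fun_prop, ?_⟩
  rw [hasFiniteIntegral_iff_ofReal (ae_of_all _ fun x => abs_nonneg x), lintegral_abs_expMeasure hη]
  exact ENNReal.ofReal_lt_top

theorem integral_abs_expMeasure {η : ℝ} (hη : 0 < η) :
    ∫ x, |x| ∂(expMeasure η) = 1 / η := by
  rw [integral_eq_lintegral_of_nonneg_ae (ae_of_all _ fun x => abs_nonneg x) (by fun_prop),
    lintegral_abs_expMeasure hη, ENNReal.toReal_ofReal (by positivity)]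

end ProbabilityTheory

namespace StatGame

open ProbabilityTheory

theorem isProbabilityMeasure_noiseLaw (d : ℕ) {η : ℝ} (hη : 0 < η) :
    IsProbabilityMeasure (noiseLaw d η) := by
  have := isProbabilityMeasure_expMeasure hη
  unfold noiseLaw
  infer_instance

theorem integrable_sum_abs_noiseLaw (d : ℕ) {η : ℝ} (hη : 0 < η) :
    Integrable (fun σ : Fin d → ℝ => ∑ j, |σ j|) (noiseLaw d η) := by
  have := isProbabilityMeasure_expMeasure hη
  exact integrable_finsetSum _ fun j _ => integrable_comp_eval (integrable_abs_expMeasure hη)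

theorem integral_sum_abs_noiseLaw (d : ℕ) {η : ℝ} (hη : 0 < η) :
    ∫ σ, ∑ j, |σ j| ∂(noiseLaw d η) = d / η := by
  have := isProbabilityMeasure_expMeasure hη
  unfold noiseLaw
  rw [integral_finsetSum _ fun j _ => integrable_comp_eval (integrable_abs_expMeasure hη)]
  have h : ∀ j : Fin d, ∫ σ : Fin d → ℝ, |σ j| ∂(Measure.pi fun _ => expMeasure η) = 1 / η := by
    intro j
    rw [← integral_abs_expMeasure hη]
    exact integral_comp_eval (μ := fun _ : Fin d => expMeasure η) (f := fun x : ℝ => |x|)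
      (by fun_prop)
  simp [h, div_eq_mul_inv]

/-- Shifting one coordinate of the exponential noise by `c ≥ 0` increases its density by a factor
of at most `exp (η c)`. -/
theorem smul_map_add_single_noiseLaw_le {d : ℕ} {η c : ℝ} (hη : 0 < η) (hc : 0 ≤ c) (i : Fin d) :
    ENNReal.ofReal (Real.exp (-(η * c))) •
      Measure.map (fun σ => σ + Pi.single i c) (noiseLaw d η) ≤ noiseLaw d η := by
  have := isProbabilityMeasure_expMeasure hη
  refine Measure.le_pi_of_forall_box_le fun s hs => ?_
  rw [Measure.smul_apply, Measure.map_apply (by fun_prop) (MeasurableSet.univ_pi hs)]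
  have hpre : (fun σ : Fin d → ℝ => σ + Pi.single i c) ⁻¹' (Set.univ.pi s) =
      Set.univ.pi fun j => (fun x => x + (Pi.single i c : Fin d → ℝ) j) ⁻¹' (s j) := by
    ext σ; simp
  rw [hpre, noiseLaw, Measure.pi_pi, smul_eq_mul]
  have hprod : ENNReal.ofReal (Real.exp (-(η * c))) =
      ∏ j, if j = i then ENNReal.ofReal (Real.exp (-(η * c))) else 1 := by simp
  rw [hprod, ← Finset.prod_mul_distrib]
  refine Finset.prod_le_prod' fun j _ => ?_
  by_cases hj : j = i
  · subst hj
    simpa using ofReal_exp_mul_expMeasure_preimage_add_le hc (hs j)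
  · simp [hj]

/-- Domination of the shifted law, applied to `ψ - a ≥ 0`, loses a factor `exp (-ηc) ≥ 1 - ηc`; the
lost share of an integral that is at most `D` costs at most `ηcD`. -/
theorem integral_add_single_noiseLaw_le {d : ℕ} {η c a D : ℝ} (hη : 0 < η) (hc : 0 ≤ c)
    (i : Fin d) {ψ : (Fin d → ℝ) → ℝ} (hψ : Measurable ψ) (hl : ∀ σ, a ≤ ψ σ)
    (hu : ∀ σ, ψ σ ≤ a + D) :
    ∫ σ, ψ (σ + Pi.single i c) ∂(noiseLaw d η) ≤ ∫ σ, ψ σ ∂(noiseLaw d η) + η * c * D := by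
  have := isProbabilityMeasure_noiseLaw d hη
  have hτ : Measurable fun σ : Fin d → ℝ => σ + Pi.single i c := by fun_prop
  have hint : Integrable ψ (noiseLaw d η) :=
    Integrable.of_mem_Icc a (a + D) hψ.aemeasurable (ae_of_all _ fun σ => ⟨hl σ, hu σ⟩)
  have hint' : Integrable (fun σ => ψ (σ + Pi.single i c)) (noiseLaw d η) :=
    Integrable.of_mem_Icc a (a + D) (hψ.comp hτ).aemeasurable
      (ae_of_all _ fun σ => ⟨hl _, hu _⟩)
  have hmono := integral_mono_measure (smul_map_add_single_noiseLaw_le hη hc i)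
    (f := fun σ => ψ σ - a) (ae_of_all _ fun σ => sub_nonneg.2 (hl σ))
    (hint.sub (integrable_const a))
  rw [integral_smul_measure, integral_map hτ.aemeasurable
    (hψ.sub_const a).aestronglyMeasurable, ENNReal.toReal_ofReal (Real.exp_pos _).le,
    integral_sub hint (integrable_const a), integral_sub hint' (integrable_const a)] at hmono
  simp only [integral_const, probReal_univ, smul_eq_mul, one_mul] at hmono
  have hub : ∫ σ, ψ (σ + Pi.single i c) ∂(noiseLaw d η) ≤ a + D := by
    simpa using integral_mono hint' (integrable_const (a + D)) fun σ => hu _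
  have hlb : a ≤ ∫ σ, ψ (σ + Pi.single i c) ∂(noiseLaw d η) := by
    simpa using integral_mono (integrable_const a) hint' fun σ => hl _
  have hexp : 1 - η * c ≤ Real.exp (-(η * c)) := by
    have := Real.add_one_le_exp (-(η * c)); linarith
  have h0 : 0 ≤ η * c := by positivity
  nlinarith [mul_le_mul_of_nonneg_right hexp (sub_nonneg.2 hlb),
    mul_le_mul_of_nonneg_left hub h0]

end StatGame

/-! ### Regularity of the risk and of the perturbed objective. -/

namespace StatGame

variable {d n : ℕ} {𝒳 : Type*} [MeasurableSpace 𝒳] {G : StatGame d n 𝒳}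

theorem abs_coord_sub_le_diam (θ₁ θ₂ : G.Θ) (j : Fin d) :
    |(θ₁ : Fin d → ℝ) j - (θ₂ : Fin d → ℝ) j| ≤ Metric.diam G.Θ := by
  rw [← Real.dist_eq]
  exact (dist_le_pi_dist _ _ j).trans
    (Metric.dist_le_diam_of_mem G.isCompact.isBounded θ₁.2 θ₂.2)

theorem exists_coord_mem_Icc (G : StatGame d n 𝒳) (j : Fin d) :
    ∃ a : ℝ, ∀ θ : G.Θ, a ≤ (θ : Fin d → ℝ) j ∧ (θ : Fin d → ℝ) j ≤ a + Metric.diam G.Θ := by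
  obtain ⟨m, hm, hmin⟩ := G.isCompact.exists_isMinOn G.nonempty
    (continuous_apply (A := fun _ : Fin d => ℝ) j).continuousOn
  refine ⟨m j, fun θ => ⟨hmin θ.2, ?_⟩⟩
  have := (abs_le.1 (abs_coord_sub_le_diam θ ⟨m, hm⟩ j)).2
  simp only at this
  linarith

theorem measurable_coord (j : Fin d) : Measurable fun θ : G.Θ => (θ : Fin d → ℝ) j :=
  (measurable_pi_apply j).comp measurable_subtype_coe

theorem sum_abs_sub_le_diam (θ₁ θ₂ : G.Θ) :
    ∑ j, |(θ₁ : Fin d → ℝ) j - (θ₂ : Fin d → ℝ) j| ≤ d * Metric.diam G.Θ := by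
  simpa using Finset.sum_le_card_nsmul Finset.univ _ _
    fun j _ => abs_coord_sub_le_diam θ₁ θ₂ j

theorem RiskLipschitz.continuous_risk {L : ℝ} (hL : 0 < L) (h : G.RiskLipschitz L)
    (e : G.Estimator) : Continuous (G.risk e) := by
  refine (LipschitzWith.of_dist_le_mul (K := (L * d).toNNReal) fun θ₁ θ₂ => ?_).continuous
  rw [Real.dist_eq]
  refine (h e θ₁ θ₂).trans ?_
  rw [Real.coe_toNNReal _ (by positivity), mul_assoc]
  refine mul_le_mul_of_nonneg_left ?_ hL.le
  simpa using Finset.sum_le_card_nsmul Finset.univ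
    (fun j => |(θ₁ : Fin d → ℝ) j - (θ₂ : Fin d → ℝ) j|) (dist θ₁ θ₂)
    fun j _ => by
      rw [← Real.dist_eq]
      exact dist_le_pi_dist (θ₁ : Fin d → ℝ) θ₂ j

theorem RiskLipschitz.abs_risk_sub_le {L : ℝ} (hL : 0 < L) (h : G.RiskLipschitz L)
    (e : G.Estimator) (θ₁ θ₂ : G.Θ) :
    |G.risk e θ₁ - G.risk e θ₂| ≤ L * (d * Metric.diam G.Θ) :=
  (h e θ₁ θ₂).trans (mul_le_mul_of_nonneg_left (sum_abs_sub_le_diam θ₁ θ₂) hL.le)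

theorem RiskLipschitz.integrable_risk {L : ℝ} (hL : 0 < L) (h : G.RiskLipschitz L)
    (e : G.Estimator) (P : Measure G.Θ) [IsFiniteMeasure P] : Integrable (G.risk e) P := by
  obtain ⟨m, hm⟩ := G.nonempty
  refine Integrable.of_mem_Icc (G.risk e ⟨m, hm⟩ - L * (d * Metric.diam G.Θ))
    (G.risk e ⟨m, hm⟩ + L * (d * Metric.diam G.Θ))
    (h.continuous_risk hL e).measurable.aemeasurable (ae_of_all _ fun θ => ?_)
  have := abs_le.1 (h.abs_risk_sub_le hL e θ ⟨m, hm⟩)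
  constructor <;> linarith

theorem perturbedRisk_add_single (l : List G.Estimator) (σ : Fin d → ℝ) (i : Fin d) (c : ℝ)
    (θ : G.Θ) :
    G.perturbedRisk l (σ + Pi.single i c) θ = G.perturbedRisk l σ θ + c * (θ : Fin d → ℝ) i := by
  simp [perturbedRisk, add_mul, Finset.sum_add_distrib, Pi.single_apply, add_assoc]

theorem perturbedRisk_append_singleton (l : List G.Estimator) (e : G.Estimator) (σ : Fin d → ℝ)
    (θ : G.Θ) :
    G.perturbedRisk (l ++ [e]) σ θ = G.perturbedRisk l σ θ + G.risk e θ := by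
  simp only [perturbedRisk, List.map_append, List.sum_append, List.map_cons, List.map_nil,
    List.sum_singleton]
  ring

theorem sum_abs_add_single_le (σ : Fin d → ℝ) (i : Fin d) {c : ℝ} (hc : 0 ≤ c) :
    ∑ j, |(σ + Pi.single i c : Fin d → ℝ) j| ≤ ∑ j, |σ j| + c := by
  have h : ∑ j, |(Pi.single i c : Fin d → ℝ) j| = c := by
    simp [Pi.single_apply, apply_ite abs, abs_of_nonneg hc]
  calc _ ≤ ∑ j, (|σ j| + |(Pi.single i c : Fin d → ℝ) j|) :=
        Finset.sum_le_sum fun j _ => abs_add_le _ _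
    _ = _ := by rw [Finset.sum_add_distrib, h]

/-! ### Regret of follow the perturbed leader. -/

section Oracle

variable {L α β η : ℝ} {N : ℕ} {O : List G.Estimator → (Fin d → ℝ) → G.Θ}

/-- The oracle's output competes with itself. -/
theorem IsMaxOracle.error_nonneg (hO : G.IsMaxOracle α β N O) (σ : Fin d → ℝ) :
    0 ≤ α + β * ∑ j, |σ j| := by
  have := (hO [] (by simp)).2 σ (O [] σ)
  linarith

theorem IsMaxOracle.alpha_nonneg (hO : G.IsMaxOracle α β N O) : 0 ≤ α := by
  simpa using hO.error_nonneg 0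

theorem IsMaxOracle.beta_nonneg (hd : 0 < d) (hO : G.IsMaxOracle α β N O) : 0 ≤ β := by
  by_contra! hβ
  -- For negative `β` this perturbation makes the error exactly `-1`.
  have h := hO.error_nonneg (Pi.single ⟨0, hd⟩ ((α + 1) / -β))
  have hα := hO.alpha_nonneg
  have hpos : 0 ≤ (α + 1) / -β := div_nonneg (by linarith) (by linarith)
  have hs : ∑ j, |(Pi.single ⟨0, hd⟩ ((α + 1) / -β) : Fin d → ℝ) j| = (α + 1) / -β := by
    simp only [Pi.single_apply, apply_ite abs, abs_zero, abs_of_nonneg hpos]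
    simp
  rw [hs] at h
  have : β * ((α + 1) / -β) = -(α + 1) := by
    rw [div_neg, mul_neg, mul_div_cancel₀ _ hβ.ne]
  linarith

/-- Raising coordinate `i` of the perturbation by `c` raises that coordinate of the perturbed
leaders before and after a round above both earlier values, up to the stated error. -/
theorem IsMaxOracle.max_coord_le_min_coord_shift (hβ : 0 ≤ β) (hO : G.IsMaxOracle α β N O)
    (hLip : G.RiskLipschitz L) (hL : 0 < L) {l : List G.Estimator} (e : G.Estimator)
    (hl : l.length + 1 ≤ N) (σ : Fin d → ℝ) (i : Fin d) {c : ℝ} (hc : 0 < c) :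
    max ((O l σ : Fin d → ℝ) i) ((O (l ++ [e]) σ : Fin d → ℝ) i) ≤
      min ((O l (σ + Pi.single i c) : Fin d → ℝ) i)
        ((O (l ++ [e]) (σ + Pi.single i c) : Fin d → ℝ) i) +
      (L * ∑ j, |(O l σ : Fin d → ℝ) j - (O (l ++ [e]) σ : Fin d → ℝ) j| +
        3 * (α + β * ∑ j, |σ j|) + β * c) / c := by
  have hx := (hO l (by omega)).2
  have hy := (hO (l ++ [e]) (by simpa using hl)).2
  set σ' := σ + Pi.single i c with hσ'
  have hγ := hO.error_nonneg σ
  have hγ' : β * ∑ j, |σ' j| ≤ β * (∑ j, |σ j| + c) :=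
    mul_le_mul_of_nonneg_left (sum_abs_add_single_le σ i hc.le) hβ
  have hS := abs_le.1 (hLip e (O l σ) (O (l ++ [e]) σ))
  have hS0 : 0 ≤ L * ∑ j, |(O l σ : Fin d → ℝ) j - (O (l ++ [e]) σ : Fin d → ℝ) j| :=
    mul_nonneg hL.le (Finset.sum_nonneg fun _ _ => abs_nonneg _)
  -- Let `x`, `y` be the leaders before and after the round, `x'`, `y'` their shifted versions.
  -- Comparing `x` with `x'`, or `y` with `y'`, takes two optimality inequalities. The mixed pairs
  -- take three and leave `R(e, y) - R(e, x)`, a displacement at the unshifted `σ`. The error at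
  -- `σ'` exceeds that at `σ` by at most `βc`, whence `3(α + β‖σ‖₁) + βc`.
  have x1 := hx σ (O l σ')
  have x2 := hx σ (O (l ++ [e]) σ)
  have x3 := hx σ' (O l σ)
  have x4 := hx σ' (O (l ++ [e]) σ)
  have y1 := hy σ (O (l ++ [e]) σ')
  have y2 := hy σ (O l σ)
  have y3 := hy σ' (O (l ++ [e]) σ)
  have y4 := hy σ' (O l σ)
  simp only [hσ', perturbedRisk_add_single, perturbedRisk_append_singleton] at x1 x3 x4 y1 y2 y3 y4
  simp only [← hσ'] at x1 x3 x4 y1 y3 y4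
  set E := L * ∑ j, |(O l σ : Fin d → ℝ) j - (O (l ++ [e]) σ : Fin d → ℝ) j| with hE
  have key : ∀ u v : ℝ, c * u - c * v ≤ E + 3 * (α + β * ∑ j, |σ j|) + β * c →
      u ≤ v + (E + 3 * (α + β * ∑ j, |σ j|) + β * c) / c := by
    intro u v h
    rw [← sub_le_iff_le_add', le_div_iff₀ hc]
    linarith
  rw [← min_add_add_right]
  refine max_le (le_min ?_ ?_) (le_min ?_ ?_) <;> refine key _ _ ?_ <;> linarith

/-- Stability of follow the perturbed leader: the expected displacement in one round. -/
theorem IsMaxOracle.integral_displacement_le (hd : 0 < d) (hO : G.IsMaxOracle α β N O)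
    (hLip : G.RiskLipschitz L) (hL : 0 < L) (hη : 0 < η) {l : List G.Estimator} (e : G.Estimator)
    (hl : l.length + 1 ≤ N) :
    Integrable (fun σ => ∑ j, |(O l σ : Fin d → ℝ) j - (O (l ++ [e]) σ : Fin d → ℝ) j|)
      (noiseLaw d η) ∧
    L * ∫ σ, ∑ j, |(O l σ : Fin d → ℝ) j - (O (l ++ [e]) σ : Fin d → ℝ) j| ∂(noiseLaw d η) ≤
      16 / 3 * (η * L ^ 2 * d ^ 2 * Metric.diam G.Θ) + (α + β * (d / η)) + 4 / 3 * (L * d * β) := by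
  have := isProbabilityMeasure_noiseLaw d hη
  have hβ := hO.beta_nonneg hd
  have hmx : ∀ j, Measurable fun σ => (O l σ : Fin d → ℝ) j := fun j =>
    (measurable_coord j).comp (hO l (by omega)).1
  have hmy : ∀ j, Measurable fun σ => (O (l ++ [e]) σ : Fin d → ℝ) j := fun j =>
    (measurable_coord j).comp (hO (l ++ [e]) (by simpa using hl)).1
  have hbdd : ∀ j (f : (Fin d → ℝ) → ℝ), Measurable f →
      (∀ σ, f σ ∈ (fun θ : G.Θ => (θ : Fin d → ℝ) j) '' Set.univ) →
      Integrable f (noiseLaw d η) := by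
    intro j f hf h
    obtain ⟨a, ha⟩ := G.exists_coord_mem_Icc j
    refine Integrable.of_mem_Icc a (a + Metric.diam G.Θ) hf.aemeasurable (ae_of_all _ fun σ => ?_)
    obtain ⟨θ, -, hθ⟩ := h σ
    exact hθ ▸ ha θ
  have hix : ∀ j, Integrable (fun σ => (O l σ : Fin d → ℝ) j) (noiseLaw d η) := fun j =>
    hbdd j _ (hmx j) fun σ => ⟨_, trivial, rfl⟩
  have hiy : ∀ j, Integrable (fun σ => (O (l ++ [e]) σ : Fin d → ℝ) j) (noiseLaw d η) := fun j =>
    hbdd j _ (hmy j) fun σ => ⟨_, trivial, rfl⟩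
  have hiabs : ∀ j, Integrable
      (fun σ => |(O l σ : Fin d → ℝ) j - (O (l ++ [e]) σ : Fin d → ℝ) j|) (noiseLaw d η) :=
    fun j => ((hix j).sub (hiy j)).abs
  have hiS : Integrable (fun σ => ∑ j, |(O l σ : Fin d → ℝ) j - (O (l ++ [e]) σ : Fin d → ℝ) j|)
      (noiseLaw d η) := integrable_finsetSum _ fun j _ => hiabs j
  refine ⟨hiS, ?_⟩
  have hd' : (0 : ℝ) < d := by exact_mod_cast hd
  set S := ∫ σ, ∑ j, |(O l σ : Fin d → ℝ) j - (O (l ++ [e]) σ : Fin d → ℝ) j| ∂(noiseLaw d η)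
    with hS
  -- Summed over `d` coordinates, the term `L * S / c` returns as `d * (L * S) / c`; this `c` makes
  -- it `S / 4`, which can be absorbed.
  set c := 4 * L * d with hc_def
  have hc : 0 < c := by positivity
  have hcoord : ∀ j, ∫ σ, |(O l σ : Fin d → ℝ) j - (O (l ++ [e]) σ : Fin d → ℝ) j|
      ∂(noiseLaw d η) ≤ η * c * Metric.diam G.Θ +
        (L * S + 3 * (α + β * (d / η)) + β * c) / c := by
    intro j
    obtain ⟨a, ha⟩ := G.exists_coord_mem_Icc j
    set φ : (Fin d → ℝ) → ℝ := fun σ =>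
      min ((O l σ : Fin d → ℝ) j) ((O (l ++ [e]) σ : Fin d → ℝ) j) with hφ
    have hφm : Measurable φ := (hmx j).min (hmy j)
    have hφl : ∀ σ, a ≤ φ σ := fun σ => le_min (ha _).1 (ha _).1
    have hφu : ∀ σ, φ σ ≤ a + Metric.diam G.Θ := fun σ => (min_le_left _ _).trans (ha _).2
    have hiφ : Integrable φ (noiseLaw d η) := (hix j).inf (hiy j)
    have hiφ' : Integrable (fun σ => φ (σ + Pi.single j c)) (noiseLaw d η) :=
      Integrable.of_mem_Icc a (a + Metric.diam G.Θ) (hφm.comp (by fun_prop)).aemeasurable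
        (ae_of_all _ fun σ => ⟨hφl _, hφu _⟩)
    have hshift := integral_add_single_noiseLaw_le hη hc.le j hφm hφl hφu
    have hierr : Integrable (fun σ : Fin d → ℝ => (L * ∑ j, |(O l σ : Fin d → ℝ) j -
        (O (l ++ [e]) σ : Fin d → ℝ) j| + 3 * (α + β * ∑ j, |σ j|) + β * c) / c)
        (noiseLaw d η) :=
      (((hiS.const_mul L).add (((integrable_const α).add
        ((integrable_sum_abs_noiseLaw d hη).const_mul β)).const_mul 3)).add
        (integrable_const (β * c))).div_const c
    have herr : ∫ σ, (L * ∑ j, |(O l σ : Fin d → ℝ) j -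
        (O (l ++ [e]) σ : Fin d → ℝ) j| + 3 * (α + β * ∑ j, |σ j|) + β * c) / c ∂(noiseLaw d η) =
        (L * S + 3 * (α + β * (d / η)) + β * c) / c := by
      have hi1 : Integrable (fun σ : Fin d → ℝ => α + β * ∑ j, |σ j|) (noiseLaw d η) :=
        (integrable_const α).add ((integrable_sum_abs_noiseLaw d hη).const_mul β)
      rw [integral_div, integral_add ((hiS.const_mul L).fun_add (hi1.const_mul 3)) (integrable_const _),
        integral_add (hiS.const_mul L) (hi1.const_mul 3), integral_const_mul, integral_const_mul,
        integral_add (integrable_const _) ((integrable_sum_abs_noiseLaw d hη).const_mul β),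
        integral_const_mul, integral_sum_abs_noiseLaw d hη]
      simp [hS]
    calc ∫ σ, |(O l σ : Fin d → ℝ) j - (O (l ++ [e]) σ : Fin d → ℝ) j| ∂(noiseLaw d η)
        ≤ ∫ σ, ((φ (σ + Pi.single j c) - φ σ) + (L * ∑ j, |(O l σ : Fin d → ℝ) j -
          (O (l ++ [e]) σ : Fin d → ℝ) j| + 3 * (α + β * ∑ j, |σ j|) + β * c) / c)
            ∂(noiseLaw d η) := by
          refine integral_mono (hiabs j) ((hiφ'.sub hiφ).add hierr) fun σ => ?_
          have := hO.max_coord_le_min_coord_shift hβ hLip hL e hl σ j hc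
          simp only [hφ]
          -- The displacement is maximum minus minimum, and the maximum is bounded by the shifted
          -- minimum plus the error.
          rw [← max_sub_min_eq_abs']
          linarith
      _ = (∫ σ, φ (σ + Pi.single j c) ∂(noiseLaw d η) - ∫ σ, φ σ ∂(noiseLaw d η)) +
          (L * S + 3 * (α + β * (d / η)) + β * c) / c := by
          rw [integral_add (hiφ'.sub' hiφ) hierr, integral_sub hiφ' hiφ, herr]
      _ ≤ _ := by linarith
  have hsum : S ≤ d * (η * c * Metric.diam G.Θ +
      (L * S + 3 * (α + β * (d / η)) + β * c) / c) := by
    have h := Finset.sum_le_card_nsmul Finset.univ _ _ fun j _ => hcoord j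
    rwa [← integral_finsetSum _ fun j _ => hiabs j, Finset.card_univ, Fintype.card_fin,
      nsmul_eq_mul] at h
  have hexp : L * (d * (η * c * Metric.diam G.Θ +
      (L * S + 3 * (α + β * (d / η)) + β * c) / c)) =
      4 * (η * L ^ 2 * d ^ 2 * Metric.diam G.Θ) + L * S / 4 + 3 / 4 * (α + β * (d / η)) +
        L * d * β := by
    rw [hc_def]
    field_simp
    ring
  -- Absorbing `L * S / 4` on the left multiplies the rest by `4/3`, giving the coefficients `16/3`,
  -- `1` and `4/3`.
  have := mul_le_mul_of_nonneg_left hsum hL.le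
  rw [hexp] at this
  linarith

/-- The be-the-leader inequality for the approximate perturbed leaders. -/
theorem IsMaxOracle.sum_risk_le_sum_risk_next (hO : G.IsMaxOracle α β N O)
    (l : ℕ → List G.Estimator) (e : ℕ → G.Estimator) (h0 : l 0 = [])
    (hsucc : ∀ t, l (t + 1) = l t ++ [e t]) (σ : Fin d → ℝ) (θ : G.Θ) :
    ∑ t ∈ Finset.range N, G.risk (e t) θ ≤
      ∑ t ∈ Finset.range N, G.risk (e t) (O (l (t + 1)) σ) + Metric.diam G.Θ * ∑ j, |σ j| +
        (N + 1) * (α + β * ∑ j, |σ j|) := by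
  have hlen : ∀ t, (l t).length = t := by
    intro t
    induction t with
    | zero => simp [h0]
    | succ t ih => simp [hsucc, ih]
  have hpert : ∀ t θ, G.perturbedRisk (l t) σ θ =
      ∑ s ∈ Finset.range t, G.risk (e s) θ + ∑ j, σ j * (θ : Fin d → ℝ) j := by
    intro t θ
    induction t with
    | zero => simp [h0, perturbedRisk]
    | succ t ih => rw [hsucc, perturbedRisk_append_singleton, ih, Finset.sum_range_succ]; ring
  -- Each step lets the leader on `l t` compete with the next leader, at the cost of one oracle
  -- error. These `N` errors and one more for the final comparison with `θ` make `N + 1`.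
  have hbtl : ∀ t ≤ N, G.perturbedRisk (l t) σ (O (l t) σ) ≤
      ∑ s ∈ Finset.range t, G.risk (e s) (O (l (s + 1)) σ) +
        ∑ j, σ j * (O (l 0) σ : Fin d → ℝ) j + t * (α + β * ∑ j, |σ j|) := by
    intro t
    induction t with
    | zero => intro _; simp [h0, perturbedRisk]
    | succ t ih =>
      intro ht
      have h1 := ih (by omega)
      have h2 := (hO (l t) (by rw [hlen]; omega)).2 σ (O (l (t + 1)) σ)
      have h3 : G.perturbedRisk (l (t + 1)) σ (O (l (t + 1)) σ) =
          G.perturbedRisk (l t) σ (O (l (t + 1)) σ) + G.risk (e t) (O (l (t + 1)) σ) := by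
        conv_lhs => rw [hsucc t, perturbedRisk_append_singleton, ← hsucc t]
      rw [h3, Finset.sum_range_succ]
      push_cast
      linarith
  have h1 := hbtl N le_rfl
  have h2 := (hO (l N) (hlen N).le).2 σ θ
  rw [hpert N θ] at h2
  have h3 : ∑ j, σ j * (O (l 0) σ : Fin d → ℝ) j - ∑ j, σ j * (θ : Fin d → ℝ) j ≤
      Metric.diam G.Θ * ∑ j, |σ j| := by
    rw [← Finset.sum_sub_distrib, Finset.mul_sum]
    refine Finset.sum_le_sum fun j _ => ?_
    rw [← mul_sub]
    refine (le_abs_self _).trans ?_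
    rw [abs_mul, mul_comm]
    exact mul_le_mul_of_nonneg_right (abs_coord_sub_le_diam _ _ j) (abs_nonneg _)
  linarith

/-- Regret bound for follow the perturbed leader with general rate `η`. -/
theorem IsMaxOracle.sum_risk_le_sum_bayesRisk (hd : 0 < d) (hO : G.IsMaxOracle α β N O)
    (hLip : G.RiskLipschitz L) (hL : 0 < L) (hη : 0 < η)
    (l : ℕ → List G.Estimator) (e : ℕ → G.Estimator) (h0 : l 0 = [])
    (hsucc : ∀ t, l (t + 1) = l t ++ [e t]) (θ : G.Θ) :
    ∑ t ∈ Finset.range N, G.risk (e t) θ ≤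
      ∑ t ∈ Finset.range N, G.bayesRisk (e t) (Measure.map (O (l t)) (noiseLaw d η)) +
        N * (16 / 3 * (η * L ^ 2 * d ^ 2 * Metric.diam G.Θ) + (α + β * (d / η)) +
          4 / 3 * (L * d * β)) +
        Metric.diam G.Θ * (d / η) + (N + 1) * (α + β * (d / η)) := by
  have := isProbabilityMeasure_noiseLaw d hη
  have hlen : ∀ t, (l t).length = t := by
    intro t
    induction t with
    | zero => simp [h0]
    | succ t ih => simp [hsucc, ih]
  have hmeas : ∀ t ∈ Finset.range N, Measurable (O (l t)) := fun t ht =>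
    (hO (l t) (by rw [hlen]; exact (Finset.mem_range.1 ht).le)).1
  have hrisk : ∀ t ∈ Finset.range N, Integrable (fun σ => G.risk (e t) (O (l t) σ))
      (noiseLaw d η) := by
    intro t ht
    have := Measure.isProbabilityMeasure_map (μ := noiseLaw d η) (hmeas t ht).aemeasurable
    exact (hLip.integrable_risk hL (e t) (Measure.map (O (l t)) (noiseLaw d η))).comp_measurable
      (hmeas t ht)
  have hbayes : ∀ t ∈ Finset.range N,
      G.bayesRisk (e t) (Measure.map (O (l t)) (noiseLaw d η)) =
        ∫ σ, G.risk (e t) (O (l t) σ) ∂(noiseLaw d η) := fun t ht =>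
    integral_map (hmeas t ht).aemeasurable
      (hLip.continuous_risk hL (e t)).measurable.aestronglyMeasurable
  have hdisp : ∀ t ∈ Finset.range N,
      Integrable (fun σ => ∑ j, |(O (l t) σ : Fin d → ℝ) j - (O (l (t + 1)) σ : Fin d → ℝ) j|)
        (noiseLaw d η) ∧
      L * ∫ σ, ∑ j, |(O (l t) σ : Fin d → ℝ) j - (O (l (t + 1)) σ : Fin d → ℝ) j|
        ∂(noiseLaw d η) ≤
        16 / 3 * (η * L ^ 2 * d ^ 2 * Metric.diam G.Θ) + (α + β * (d / η)) +
          4 / 3 * (L * d * β) := by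
    intro t ht
    rw [hsucc]
    exact hO.integral_displacement_le hd hLip hL hη (e t)
      (by rw [hlen]; exact Finset.mem_range.1 ht)
  have hnoise := integrable_sum_abs_noiseLaw d hη
  -- One draw `σ` may serve all rounds: the `e t` do not depend on `σ`, and only the expectation of
  -- each round's risk matters. The Lipschitz bound trades the next leader for the current one,
  -- whose expected risk is the Bayes risk.
  have hpt : ∀ σ : Fin d → ℝ, ∑ t ∈ Finset.range N, G.risk (e t) θ ≤
      ∑ t ∈ Finset.range N, G.risk (e t) (O (l t) σ) +
      ∑ t ∈ Finset.range N,
        L * ∑ j, |(O (l t) σ : Fin d → ℝ) j - (O (l (t + 1)) σ : Fin d → ℝ) j| +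
      Metric.diam G.Θ * ∑ j, |σ j| + (N + 1) * (α + β * ∑ j, |σ j|) := by
    intro σ
    refine (hO.sum_risk_le_sum_risk_next l e h0 hsucc σ θ).trans ?_
    rw [← Finset.sum_add_distrib]
    gcongr with t _
    have := (abs_le.1 (hLip (e t) (O (l t) σ) (O (l (t + 1)) σ))).1
    linarith
  have hi1 := integrable_finsetSum (Finset.range N) hrisk
  have hi2 := integrable_finsetSum (Finset.range N) fun t ht => (hdisp t ht).1.const_mul L
  have hi3 := hnoise.const_mul (Metric.diam G.Θ)
  have hi4 : Integrable (fun σ : Fin d → ℝ => α + β * ∑ j, |σ j|) (noiseLaw d η) :=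
    (integrable_const α).add (hnoise.const_mul β)
  have hint := integral_mono (integrable_const _)
    (((hi1.add hi2).add hi3).add (hi4.const_mul ((N : ℝ) + 1))) hpt
  simp only [Pi.add_apply] at hint
  rw [integral_add ((hi1.fun_add hi2).fun_add hi3) (hi4.const_mul _),
    integral_add (hi1.fun_add hi2) hi3,
    integral_add hi1 hi2, integral_finsetSum _ hrisk,
    integral_finsetSum _ fun t ht => (hdisp t ht).1.const_mul L, integral_const_mul,
    integral_const_mul, integral_add (integrable_const _) (hnoise.const_mul β),
    integral_const_mul, integral_sum_abs_noiseLaw d hη, ← Finset.sum_congr rfl hbayes] at hint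
  simp only [integral_const, probReal_univ, smul_eq_mul, one_mul, integral_const_mul] at hint
  have hstab := Finset.sum_le_card_nsmul _ _ _ fun t ht => (hdisp t ht).2
  rw [Finset.card_range, nsmul_eq_mul] at hstab
  linarith

end Oracle

/-- The general regret bound at the rate `η = (d L² T)^(-1/2)`. -/
theorem regret_bound_at_rate_le {d T : ℕ} (hd : 0 < d) (hT : 0 < T) {L α β D η : ℝ} (hL : 0 < L)
    (hα : 0 ≤ α) (hβ : 0 ≤ β) (hD : 0 ≤ D) (hη : η = √(1 / ((d : ℝ) * L ^ 2 * (T : ℝ)))) :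
    (T : ℝ)⁻¹ * (T * (16 / 3 * (η * L ^ 2 * d ^ 2 * D) + (α + β * (d / η)) +
        4 / 3 * (L * d * β)) + D * (d / η) + (T + 1) * (α + β * (d / η))) ≤
      7 * (D * (d : ℝ) ^ (3 / 2 : ℝ) * L * (T : ℝ) ^ (-(1 / 2) : ℝ) + α +
        β * (d : ℝ) ^ (3 / 2 : ℝ) * L * (T : ℝ) ^ (1 / 2 : ℝ)) := by
  have hd1 : (1 : ℝ) ≤ d := by exact_mod_cast hd
  have hT1 : (1 : ℝ) ≤ T := by exact_mod_cast hT
  have hpow : (d : ℝ) ^ (3 / 2 : ℝ) = √d ^ 3 := by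
    rw [Real.sqrt_eq_rpow, ← Real.rpow_natCast, ← Real.rpow_mul (by positivity)]
    norm_num
  have hη' : η = (L * √d * √T)⁻¹ := by
    rw [hη, one_div, Real.sqrt_inv, Real.sqrt_mul (by positivity), Real.sqrt_mul (by positivity),
      Real.sqrt_sq hL.le, mul_comm L]
  rw [hpow, Real.rpow_neg (by positivity), ← Real.sqrt_eq_rpow, hη']
  have hs1 : 1 ≤ √(d : ℝ) := Real.one_le_sqrt.2 hd1
  have ht1 : 1 ≤ √(T : ℝ) := Real.one_le_sqrt.2 hT1
  obtain ⟨s, hs⟩ : ∃ s, s = √(d : ℝ) := ⟨_, rfl⟩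
  obtain ⟨t, ht⟩ : ∃ t, t = √(T : ℝ) := ⟨_, rfl⟩
  have hds : (d : ℝ) = s ^ 2 := by rw [hs, Real.sq_sqrt (by positivity)]
  have hTt : (T : ℝ) = t ^ 2 := by rw [ht, Real.sq_sqrt (by positivity)]
  rw [← hs] at hs1 ⊢
  rw [← ht] at ht1 ⊢
  rw [hTt] at hT1
  rw [hds, hTt]
  have hs0 : 0 < s := by linarith
  have ht0 : 0 < t := by linarith
  have hst : 1 ≤ s * t := one_le_mul_of_one_le_of_one_le hs1 ht1
  have hA : 0 ≤ D * s ^ 3 * L * t⁻¹ := by positivity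
  have hB : L * s ^ 2 * β ≤ β * s ^ 3 * L * t := by
    have := mul_le_mul_of_nonneg_left hst (by positivity : 0 ≤ L * s ^ 2 * β)
    linarith
  have hBn : 0 ≤ L * s ^ 2 * β := by positivity
  have hinv : (t ^ 2)⁻¹ ≤ 1 := inv_le_one_of_one_le₀ hT1
  -- With `s = √d` and `t = √T`, `d/η = L s³ t`. As `1/t² ≤ 1` and `L s² β ≤ β s³ L t`, the final
  -- coefficients of the `D`, `α`, `β` terms are at most `19/3`, `3`, `13/3`, all below `7`.
  have hexp : (t ^ 2)⁻¹ * (t ^ 2 * (16 / 3 * ((L * s * t)⁻¹ * L ^ 2 * (s ^ 2) ^ 2 * D) +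
      (α + β * (s ^ 2 / (L * s * t)⁻¹)) + 4 / 3 * (L * s ^ 2 * β)) +
      D * (s ^ 2 / (L * s * t)⁻¹) + (t ^ 2 + 1) * (α + β * (s ^ 2 / (L * s * t)⁻¹))) =
      19 / 3 * (D * s ^ 3 * L * t⁻¹) + (2 + (t ^ 2)⁻¹) * (α + β * s ^ 3 * L * t) +
        4 / 3 * (L * s ^ 2 * β) := by
    field_simp
    ring
  rw [hexp]
  have := mul_le_mul_of_nonneg_right hinv
    (by linarith : 0 ≤ α + β * s ^ 3 * L * t)
  linarith

/-! ### Consequences of the minimization oracle. -/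

section Oracle

variable {L α' : ℝ} {minO : Measure G.Θ → G.Estimator}

theorem IsMinOracle.error_nonneg (hO : G.IsMinOracle α' minO) : 0 ≤ α' := by
  obtain ⟨m, hm⟩ := G.nonempty
  have := hO (Measure.dirac ⟨m, hm⟩) inferInstance (minO (Measure.dirac ⟨m, hm⟩))
  linarith

/-- At a Dirac prior the Bayes risk is the risk at that point, so the oracle's near-minimality is a
lower bound there. It rules out `∞ - ∞` in `randRisk`. -/
theorem IsMinOracle.exists_le_risk (hO : G.IsMinOracle α' minO) (hL : 0 < L)
    (hLip : G.RiskLipschitz L) (θ : G.Θ) : ∃ b, ∀ e, b ≤ G.risk e θ := by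
  refine ⟨G.risk (minO (Measure.dirac θ)) θ - α', fun e => ?_⟩
  have h := hO (Measure.dirac θ) inferInstance e
  have hdirac : ∀ e, G.bayesRisk e (Measure.dirac θ) = G.risk e θ := fun e =>
    integral_dirac' _ _ (hLip.continuous_risk hL e).measurable.stronglyMeasurable
  rw [hdirac, hdirac] at h
  linarith

end Oracle

/-! ### Randomized risk and weak duality. -/

section Randomized

variable [MeasurableSpace G.Estimator]

theorem randRisk_eq_integral {μ : Measure G.Estimator} {θ : G.Θ}
    (h : Integrable (fun e => G.risk e θ) μ) :
    G.randRisk μ θ = ((∫ e, G.risk e θ ∂μ : ℝ) : EReal) := by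
  have hpos : ∫⁻ e, ENNReal.ofReal (G.risk e θ) ∂μ ≠ ⊤ := h.lintegral_lt_top.ne
  have hneg : ∫⁻ e, ENNReal.ofReal (-(G.risk e θ)) ∂μ ≠ ⊤ := h.neg.lintegral_lt_top.ne
  rw [integral_eq_lintegral_pos_part_sub_lintegral_neg_part h, randRisk, EReal.coe_sub,
    EReal.coe_ennreal_toReal hpos, EReal.coe_ennreal_toReal hneg]

/-- When the risk is bounded below, a randomized risk that is not `⊤` is a genuine integral. -/
theorem integrable_risk_of_randRisk_ne_top {μ : Measure G.Estimator} [IsFiniteMeasure μ] {θ : G.Θ}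
    (hmeas : Measurable fun e => G.risk e θ) {b : ℝ} (hb : ∀ e, b ≤ G.risk e θ)
    (h : G.randRisk μ θ ≠ ⊤) : Integrable (fun e => G.risk e θ) μ := by
  have hneg : ∫⁻ e, ENNReal.ofReal (-(G.risk e θ)) ∂μ ≠ ⊤ := by
    refine ne_top_of_le_ne_top ?_
      (lintegral_mono fun e => ENNReal.ofReal_le_ofReal (neg_le_neg (hb e)))
    simpa using ENNReal.mul_ne_top ENNReal.ofReal_ne_top (measure_ne_top μ _)
  have hpos : ∫⁻ e, ENNReal.ofReal (G.risk e θ) ∂μ ≠ ⊤ := by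
    intro htop
    refine h ?_
    rw [randRisk, htop, EReal.coe_ennreal_top]
    exact EReal.top_sub (by simpa using hneg)
  refine ⟨hmeas.aestronglyMeasurable, ?_⟩
  rw [hasFiniteIntegral_iff_norm]
  calc ∫⁻ e, ENNReal.ofReal ‖G.risk e θ‖ ∂μ
      ≤ ∫⁻ e, (ENNReal.ofReal (G.risk e θ) + ENNReal.ofReal (-(G.risk e θ))) ∂μ := by
        refine lintegral_mono fun e => ?_
        rw [Real.norm_eq_abs]
        rcases abs_cases (G.risk e θ) with ⟨h, -⟩ | ⟨h, -⟩ <;> rw [h]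
        · exact le_self_add
        · exact le_add_self
    _ = _ := lintegral_add_left hmeas.ennreal_ofReal _
    _ < ⊤ := ENNReal.add_lt_top.2 ⟨hpos.lt_top, hneg.lt_top⟩

/-- A uniform lower bound for the Bayes risk under some prior bounds the worst-case risk of every
randomized estimator from below. -/
theorem le_iSup_randRisk_of_forall_le_bayesRisk {L v : ℝ} (hL : 0 < L) (hLip : G.RiskLipschitz L)
    (hmeas : ∀ θ : G.Θ, Measurable fun e : G.Estimator => G.risk e θ)
    (hbelow : ∀ θ : G.Θ, ∃ b, ∀ e, b ≤ G.risk e θ) (P : Measure G.Θ) [IsProbabilityMeasure P]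
    (hv : ∀ e, v ≤ G.bayesRisk e P) (μ : Measure G.Estimator) [IsProbabilityMeasure μ] :
    (v : EReal) ≤ ⨆ θ : G.Θ, G.randRisk μ θ := by
  obtain ⟨S, hS⟩ : ∃ S, S = ⨆ θ : G.Θ, G.randRisk μ θ := ⟨_, rfl⟩
  rw [← hS]
  have hle : ∀ θ, G.randRisk μ θ ≤ S := fun θ => hS ▸ le_iSup (G.randRisk μ) θ
  by_cases htop : S = ⊤
  · rw [htop]; exact le_top
  have hint : ∀ θ, Integrable (fun e => G.risk e θ) μ := fun θ =>
    (hbelow θ).elim fun b hb => integrable_risk_of_randRisk_ne_top (hmeas θ) hb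
      (ne_top_of_le_ne_top htop (hle θ))
  simp only [randRisk_eq_integral (hint _)] at hle
  obtain ⟨m, hm⟩ := G.nonempty
  set θ₀ : G.Θ := ⟨m, hm⟩
  have hbot : S ≠ ⊥ := fun h => by simpa [h] using hle θ₀
  lift S to ℝ using ⟨htop, hbot⟩
  simp only [EReal.coe_le_coe_iff] at hle ⊢
  -- The risk is a Carathéodory function, continuous in `θ` and measurable in `e`; hence any
  -- σ-algebra making the risks measurable suffices for Fubini.
  have hjoint : StronglyMeasurable (Function.uncurry fun (θ : G.Θ) (e : G.Estimator) =>
      G.risk e θ) :=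
    stronglyMeasurable_uncurry_of_continuous_of_stronglyMeasurable
      (fun e => hLip.continuous_risk hL e) fun θ => (hmeas θ).stronglyMeasurable
  -- By the Lipschitz bound, the risk at the single point `θ₀` plus a constant dominates all the
  -- others.
  have hprod : Integrable (Function.uncurry fun (θ : G.Θ) (e : G.Estimator) => G.risk e θ)
      (P.prod μ) := by
    refine Integrable.mono'
      ((((hint θ₀).norm.add (integrable_const (L * (d * Metric.diam G.Θ)))).comp_snd P))
      hjoint.aestronglyMeasurable (ae_of_all _ fun p => ?_)
    have h1 := hLip.abs_risk_sub_le hL p.2 p.1 θ₀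
    have h2 := abs_sub_abs_le_abs_sub (G.risk p.2 p.1) (G.risk p.2 θ₀)
    simp only [Function.uncurry, Pi.add_apply, Real.norm_eq_abs]
    linarith
  have hswap := integral_integral_swap hprod
  have hlow : v ≤ ∫ e, ∫ θ, G.risk e θ ∂P ∂μ := by
    simpa using integral_mono (integrable_const v) hprod.integral_prod_right hv
  have hup : ∫ θ, ∫ e, G.risk e θ ∂μ ∂P ≤ S := by
    simpa using integral_mono hprod.integral_prod_left (integrable_const S) hle
  linarith

end Randomized

/-! ### Averages over the rounds of the algorithm. -/

section Algorithm

variable {L α β α' η : ℝ} {T : ℕ} {maxO : List G.Estimator → (Fin d → ℝ) → G.Θ}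
  {minO : Measure G.Θ → G.Estimator}

theorem length_history (t : ℕ) : (G.history maxO minO η t).length = t := by
  induction t with
  | zero => rfl
  | succ t ih => simp [history, ih]

theorem isProbabilityMeasure_prior (hη : 0 < η) (hmax : G.IsMaxOracle α β T maxO) {t : ℕ}
    (ht : t ≤ T) : IsProbabilityMeasure (G.prior maxO minO η t) := by
  have := isProbabilityMeasure_noiseLaw d hη
  exact Measure.isProbabilityMeasure_map
    (hmax _ (by rw [length_history]; exact ht)).1.aemeasurable

theorem isProbabilityMeasure_inv_smul_sum_range {Ω : Type*} [MeasurableSpace Ω]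
    {P : ℕ → Measure Ω} (hT : 0 < T) (hP : ∀ t < T, IsProbabilityMeasure (P t)) :
    IsProbabilityMeasure ((T : ENNReal)⁻¹ • ∑ t ∈ Finset.range T, P t) := by
  constructor
  rw [Measure.smul_apply, Measure.finsetSum_apply,
    Finset.sum_congr rfl fun t ht => (hP t (Finset.mem_range.1 ht)).measure_univ]
  simp only [Finset.sum_const, Finset.card_range, nsmul_eq_mul, mul_one, smul_eq_mul]
  exact ENNReal.inv_mul_cancel (by exact_mod_cast hT.ne') (ENNReal.natCast_ne_top T)

theorem bayesRisk_avgPrior (hL : 0 < L) (hLip : G.RiskLipschitz L) (hη : 0 < η)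
    (hmax : G.IsMaxOracle α β T maxO) (e : G.Estimator) :
    G.bayesRisk e (G.avgPrior maxO minO η T) =
      (T : ℝ)⁻¹ * ∑ t ∈ Finset.range T, G.bayesRisk e (G.prior maxO minO η t) := by
  rw [bayesRisk, avgPrior, integral_smul_measure, integral_finsetSum_measure]
  · simp [bayesRisk]
  · intro t ht
    have := isProbabilityMeasure_prior (minO := minO) hη hmax (Finset.mem_range.1 ht).le
    exact hLip.integrable_risk hL e _

theorem randRisk_rndEstimator [MeasurableSpace G.Estimator]
    (hT : 0 < T) (hmeas : ∀ θ : G.Θ, Measurable fun e : G.Estimator => G.risk e θ) (θ : G.Θ) :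
    G.randRisk (G.rndEstimator maxO minO η T) θ =
      (((T : ℝ)⁻¹ * ∑ t ∈ Finset.range T, G.risk (G.iterate maxO minO η t) θ : ℝ) : EReal) := by
  have hdirac : ∀ t ∈ Finset.range T,
      Integrable (fun e => G.risk e θ) (Measure.dirac (G.iterate maxO minO η t)) := fun t _ =>
    integrable_dirac' (hmeas θ).stronglyMeasurable (by simp)
  have hint : Integrable (fun e => G.risk e θ) (G.rndEstimator maxO minO η T) :=
    (integrable_finsetSum_measure.2 hdirac).smul_measure
      (ENNReal.inv_ne_top.2 (by exact_mod_cast hT.ne'))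
  rw [randRisk_eq_integral hint, rndEstimator, integral_smul_measure,
    integral_finsetSum_measure hdirac]
  simp [integral_dirac' _ _ (hmeas θ).stronglyMeasurable]

/-- Jensen's inequality for each sample, then integration. -/
theorem risk_avgEstimator_le (hrisk : G.HasRisk) (hT : 0 < T) (hΘ : Convex ℝ G.Θ)
    (hconv : ∀ θ : G.Θ, ConvexOn ℝ G.Θ fun a => G.loss a θ) (θ : G.Θ) :
    G.risk (G.avgEstimator maxO minO η hΘ T hT) θ ≤
      (T : ℝ)⁻¹ * ∑ t ∈ Finset.range T, G.risk (G.iterate maxO minO η t) θ := by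
  have hT0 : (T : ℝ) ≠ 0 := by exact_mod_cast hT.ne'
  have hint : Integrable (fun x => ∑ t ∈ Finset.range T,
      (T : ℝ)⁻¹ * G.loss ((G.iterate maxO minO η t).toFun x) θ) (G.sampleLaw θ) :=
    integrable_finsetSum _ fun t _ => (hrisk _ θ).const_mul _
  calc G.risk (G.avgEstimator maxO minO η hΘ T hT) θ
      ≤ ∫ x, ∑ t ∈ Finset.range T,
          (T : ℝ)⁻¹ * G.loss ((G.iterate maxO minO η t).toFun x) θ ∂(G.sampleLaw θ) := by
        refine integral_mono (hrisk _ θ) hint fun x => ?_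
        exact (hconv θ).map_sum_le (t := Finset.range T) (w := fun _ => (T : ℝ)⁻¹)
          (fun _ _ => by positivity) (by simp [hT0]) fun t _ => Subtype.coe_prop _
    _ = _ := by
        rw [integral_finsetSum _ fun t _ => (hrisk _ θ).const_mul _, Finset.mul_sum]
        simp only [integral_const_mul, risk]

end Algorithm

end StatGame

/-! ### The game value sandwich. -/

theorem corollary3 :
    ∃ C : ℝ, 0 < C ∧
      ∀ (d n T : ℕ) (_hd : 0 < d) (hT : 0 < T)
        (𝒳 : Type*) [MeasurableSpace 𝒳] (G : StatGame d n 𝒳)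
        [MeasurableSpace G.Estimator]
        (L α β α' η ε : ℝ)
        (maxO : List G.Estimator → (Fin d → ℝ) → G.Θ)
        (minO : Measure G.Θ → G.Estimator),
        -- the setting
        G.HasRisk →
        (∀ θ : G.Θ, Measurable (fun e : G.Estimator => G.risk e θ)) →
        0 < L →
        G.RiskLipschitz L →
        G.IsMaxOracle α β T maxO →
        G.IsMinOracle α' minO →
        η = √(1 / ((d : ℝ) * L ^ 2 * (T : ℝ))) →
        -- the error; `Metric.diam` is the diameter in the sup norm
        ε = C * (Metric.diam G.Θ * (d : ℝ) ^ (3 / 2 : ℝ) * L * (T : ℝ) ^ (-(1 / 2) : ℝ)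
              + α + α' + β * (d : ℝ) ^ (3 / 2 : ℝ) * L * (T : ℝ) ^ (1 / 2 : ℝ)) →
        -- worst-case risk of the randomized estimator
        (⨆ θ : G.Θ, G.randRisk (G.rndEstimator maxO minO η T) θ) ≤ G.minimaxRisk + (ε : EReal) ∧
        -- Bayes risk of the average prior
        G.minimaxRisk - (ε : EReal) ≤
          (⨅ e : G.Estimator, (G.bayesRisk e (G.avgPrior maxO minO η T) : EReal)) ∧
        -- convex losses: worst-case and Bayes risk of the averaged estimator
        ∀ hΘ : Convex ℝ G.Θ, (∀ θ : G.Θ, ConvexOn ℝ G.Θ (fun a => G.loss a θ)) →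
          (⨆ θ : G.Θ, (G.risk (G.avgEstimator maxO minO η hΘ T hT) θ : EReal)) ≤
              G.minimaxRisk + (ε : EReal) ∧
          (G.bayesRisk (G.avgEstimator maxO minO η hΘ T hT) (G.avgPrior maxO minO η T) : EReal) ≤
            (⨅ e : G.Estimator, (G.bayesRisk e (G.avgPrior maxO minO η T) : EReal))
              + (ε : EReal) := by
  refine ⟨7, by norm_num, ?_⟩
  intro d n T hd hT 𝒳 _ G _ L α β α' η ε maxO minO hrisk hmeas hL hLip hmax hmin hη hε
  have hη0 : 0 < η := by rw [hη]; positivity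
  have hα := hmax.alpha_nonneg
  have hβ := hmax.beta_nonneg hd
  have hα' := hmin.error_nonneg
  have hrate := StatGame.regret_bound_at_rate_le hd hT hL hα hβ
    (Metric.diam_nonneg (s := G.Θ)) hη
  have hTinv : (0 : ℝ) ≤ (T : ℝ)⁻¹ := by positivity
  have hTne : (T : ℝ) ≠ 0 := by positivity
  set e := G.iterate maxO minO η with he
  set P := G.prior maxO minO η with hP
  obtain ⟨v, hv⟩ : ∃ v, v = (T : ℝ)⁻¹ * ∑ t ∈ Finset.range T, G.bayesRisk (e t) (P t) :=
    ⟨_, rfl⟩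
  have hPprob : ∀ t < T, IsProbabilityMeasure (P t) := fun t ht =>
    StatGame.isProbabilityMeasure_prior hη0 hmax ht.le
  -- The regret part of `ε` does not involve `α'`, so its share `7 * α'` pays for the subtracted
  -- `α'`.
  have hregret : ∀ θ : G.Θ, (T : ℝ)⁻¹ * ∑ t ∈ Finset.range T, G.risk (e t) θ ≤ v - α' + ε := by
    intro θ
    have h := mul_le_mul_of_nonneg_left
      (hmax.sum_risk_le_sum_bayesRisk hd hLip hL hη0 (G.history maxO minO η) e rfl
        (fun _ => rfl) θ) hTinv
    rw [add_assoc, add_assoc, mul_add, ← add_assoc (_ * _)] at h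
    have hveq : (T : ℝ)⁻¹ * ∑ t ∈ Finset.range T, G.bayesRisk (e t)
        (Measure.map (maxO (G.history maxO minO η t)) (StatGame.noiseLaw d η)) = v := hv.symm
    linarith
  have hbest : ∀ e', v - α' ≤ G.bayesRisk e' (G.avgPrior maxO minO η T) := by
    intro e'
    rw [StatGame.bayesRisk_avgPrior hL hLip hη0 hmax, hv, sub_le_iff_le_add]
    have h : ∑ t ∈ Finset.range T, G.bayesRisk (e t) (P t) ≤
        ∑ t ∈ Finset.range T, (G.bayesRisk e' (P t) + α') :=
      Finset.sum_le_sum fun t ht => hmin (P t) (hPprob t (Finset.mem_range.1 ht)) e'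
    refine (mul_le_mul_of_nonneg_left h hTinv).trans (le_of_eq ?_)
    rw [Finset.sum_add_distrib, mul_add]
    simp [hTne, hP]
  have hPavg : IsProbabilityMeasure (G.avgPrior maxO minO η T) :=
    StatGame.isProbabilityMeasure_inv_smul_sum_range hT hPprob
  have hrnd : IsProbabilityMeasure (G.rndEstimator maxO minO η T) :=
    StatGame.isProbabilityMeasure_inv_smul_sum_range hT fun _ _ => inferInstance
  -- Weak duality at the average prior gives the lower end of the interval containing `R*`;
  -- `hminimax_le` gives the upper end.
  have hminimax_ge : ((v - α' : ℝ) : EReal) ≤ G.minimaxRisk :=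
    le_iInf fun μ => StatGame.le_iSup_randRisk_of_forall_le_bayesRisk hL hLip hmeas
      (hmin.exists_le_risk hL hLip) (G.avgPrior maxO minO η T) hbest μ
  have hsup : (⨆ θ : G.Θ, G.randRisk (G.rndEstimator maxO minO η T) θ) ≤
      ((v - α' + ε : ℝ) : EReal) := by
    refine iSup_le fun θ => ?_
    rw [StatGame.randRisk_rndEstimator hT hmeas]
    exact EReal.coe_le_coe_iff.2 (hregret θ)
  have hminimax_le : G.minimaxRisk ≤ ((v - α' + ε : ℝ) : EReal) :=
    (iInf_le (fun μ : ProbabilityMeasure G.Estimator =>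
      ⨆ θ : G.Θ, G.randRisk (μ : Measure G.Estimator) θ) ⟨_, hrnd⟩).trans hsup
  have hadd : ((v - α' + ε : ℝ) : EReal) ≤ G.minimaxRisk + (ε : EReal) := by
    rw [EReal.coe_add]
    exact add_le_add_left hminimax_ge _
  refine ⟨hsup.trans hadd, le_iInf fun e' => ?_, fun hΘ hconv => ?_⟩
  · refine (EReal.sub_le_of_le_add (hminimax_le.trans ?_))
    rw [← EReal.coe_add, EReal.coe_le_coe_iff]
    have := hbest e'
    linarith
  · have havg : ∀ θ : G.Θ, G.risk (G.avgEstimator maxO minO η hΘ T hT) θ ≤ v - α' + ε := fun θ =>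
      (StatGame.risk_avgEstimator_le hrisk hT hΘ hconv θ).trans (hregret θ)
    refine ⟨(iSup_le fun θ => EReal.coe_le_coe_iff.2 (havg θ)).trans hadd, ?_⟩
    refine EReal.sub_le_iff_le_add (.inl (EReal.coe_ne_bot ε)) (.inl (EReal.coe_ne_top ε)) |>.1 ?_
    refine le_iInf fun e' => ?_
    rw [← EReal.coe_sub, EReal.coe_le_coe_iff]
    have hbayes : G.bayesRisk (G.avgEstimator maxO minO η hΘ T hT) (G.avgPrior maxO minO η T) ≤
        v - α' + ε := by
      simpa [StatGame.bayesRisk] using integral_mono (hLip.integrable_risk hL _ (G.avgPrior maxO minO η T))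
        (integrable_const _) havg
    have := hbest e'
    linarith
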